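/- For $b\ge 0$ let $$\mathbb{H}(b)=\{(c,e)\in\mathbb{R}^3\times\mathbb{R}^3=\mathbb{R}^6 : c\cdot e=0,\ |c|>b\}$$ be the space of curvilinear Kepler orbits with angular momentum greater than $b$ ($c$ is the angular momentum vector, $e$ the Laplace vector, $c\cdot e$ the standard inner product and $|c|$ the Euclidean norm), with the topology induced from $\mathbb{R}^6$. Then for every real $b\ge 0$ there is no way to define the structure of a finite-dimensional topological vector space over $\mathbb{R}$ on the space $\mathbb{H}(b)$; that is, $\mathbb{H}(b)$ is not homeomorphic to any finite-dimensional real topological vector space. -/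

import Mathlib

/-- The space of curvilinear Kepler orbits with angular momentum greater than `b`: the set of
pairs `(c, e)` of vectors of Euclidean 3-space (`c` the angular momentum vector, `e` the Laplace
vector) with `c · e = 0` and `|c| > b`. As a type it carries the subspace topology of
`ℝ³ × ℝ³ = ℝ⁶`. -/
def CurvilinearOrbits (b : ℝ) :
    Set (EuclideanSpace ℝ (Fin 3) × EuclideanSpace ℝ (Fin 3)) :=
  {p | inner ℝ p.1 p.2 = 0 ∧ b < ‖p.1‖}

/-! Normalising `c` and sending a unit vector `x` to the circular orbit `((b + 1) x, 0)` make the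
2-sphere a retract up to scaling of the orbit space. A real topological vector space is
contractible, so a homeomorphism would make the sphere contractible. It is not: a contraction would
trivialise the line bundle of ranges of `spinProjection` (`exists_section_of_homotopy`), but in two
stereographic charts that bundle is glued by `z` along the unit circle, and `z` has no continuous
logarithm there. -/

/-- The identity of the unit circle has no continuous logarithm. -/
theorem not_exists_continuous_log_on_circle (f : ℂ → ℂ) (hf : Continuous f) :
    ¬ ∀ z : ℂ, ‖z‖ = 1 → Complex.exp (f z) = z := by
  intro h
  -- `g` takes values in `2πiℤ`, hence is constant, yet it drops by `2πi` over one turn.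
  let g : ℝ → ℂ := fun θ ↦ f (Complex.exp (θ * Complex.I)) - θ * Complex.I
  have hg : Continuous g := by fun_prop
  have hk (θ : ℝ) : ∃ n : ℤ, g θ = n * (2 * Real.pi * Complex.I) := by
    rw [← Complex.exp_eq_one_iff, Complex.exp_sub, h _ (Complex.norm_exp_ofReal_mul_I θ)]
    exact div_self (Complex.exp_ne_zero _)
  have hpi : (2 * Real.pi : ℝ) ≠ 0 := by positivity
  choose n hn using hk
  have him (θ : ℝ) : (n θ : ℝ) = (g θ).im / (2 * Real.pi) := by
    rw [hn θ]
    field_simp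
    simp
  have hncont : Continuous n := by
    refine Int.isClosedEmbedding_coe_real.isInducing.continuous_iff.2 ?_
    have : ((↑) : ℤ → ℝ) ∘ n = fun θ ↦ (g θ).im / (2 * Real.pi) := funext him
    rw [this]
    fun_prop
  have hconst : n 0 = n (2 * Real.pi) := PreconnectedSpace.constant inferInstance hncont
  have hgg : g 0 = g (2 * Real.pi) := by rw [hn, hn, hconst]
  refine Complex.two_pi_I_ne_zero ?_
  simp only [g, Complex.ofReal_zero, zero_mul, Complex.exp_zero, Complex.ofReal_mul,
    Complex.ofReal_ofNat, Complex.exp_two_pi_mul_I] at hgg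
  linear_combination hgg

/-- A nowhere vanishing continuous function on the plane has a continuous logarithm. -/
theorem exists_continuous_exp_eq (f : ℂ → ℂ) (hf : Continuous f) (h0 : ∀ z, f z ≠ 0) :
    ∃ g : ℂ → ℂ, Continuous g ∧ ∀ z, Complex.exp (g z) = f z := by
  obtain ⟨F, ⟨-, hF⟩, -⟩ := Complex.isCoveringMapOn_exp.existsUnique_continuousMap_lifts
    ⟨f, hf⟩ (Complex.exp_log (h0 0)) h0
  exact ⟨F, F.continuous, fun z ↦ congrFun hF z⟩

/-- The clutching function `z` of the tautological line bundle over the Riemann sphere is not a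
coboundary: it is not the quotient of two nowhere vanishing functions that extend to the discs. -/
theorem not_mul_eq_on_circle (α β : ℂ → ℂ) (hα : Continuous α) (hβ : Continuous β)
    (hα0 : ∀ z, α z ≠ 0) (hβ0 : ∀ z, β z ≠ 0) : ¬ ∀ z : ℂ, ‖z‖ = 1 → z * α z = β z := by
  intro h
  obtain ⟨φ, hφ, hφe⟩ := exists_continuous_exp_eq α hα hα0
  obtain ⟨ψ, hψ, hψe⟩ := exists_continuous_exp_eq β hβ hβ0
  refine not_exists_continuous_log_on_circle (fun z ↦ ψ z - φ z) (hψ.sub hφ) fun z hz ↦ ?_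
  rw [Complex.exp_sub, hφe, hψe, ← h z hz, mul_div_cancel_right₀ _ (hα0 z)]

/-- Nowhere vanishing sections can be transported along a homotopy of bundles of ranges of
projections over a compact space. -/
theorem exists_section_of_homotopy {K E : Type*} [TopologicalSpace K] [CompactSpace K]
    [NormedAddCommGroup E] [NormedSpace ℂ E] (P : unitInterval × K → E →L[ℂ] E)
    (hP : Continuous P) (hidem : ∀ q v, P q (P q v) = P q v)
    (h1 : ∃ v : K → E, Continuous v ∧ ∀ x, v x ≠ 0 ∧ P (1, x) (v x) = v x) :
    ∃ v : K → E, Continuous v ∧ ∀ x, v x ≠ 0 ∧ P (0, x) (v x) = v x := by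
  let S : Set unitInterval :=
    {t | ∃ v : K → E, Continuous v ∧ ∀ x, v x ≠ 0 ∧ P (t, x) (v x) = v x}
  have hstep (t s : unitInterval) (hts : ∀ x, dist (P (t, x)) (P (s, x)) < 1) (ht : t ∈ S) :
      s ∈ S := by
    obtain ⟨v, hv, hv'⟩ := ht
    -- Project the old section: if `P (s, x)` killed `v x`, then `P (t, x) - P (s, x)` would fix `v
    -- x`, although its norm is below 1.
    refine ⟨fun x ↦ P (s, x) (v x), by fun_prop, fun x ↦ ⟨fun h ↦ ?_, hidem _ _⟩⟩
    have hlt : ‖(P (t, x) - P (s, x)) (v x)‖ < ‖v x‖ := by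
      refine ((P (t, x) - P (s, x)).le_opNorm (v x)).trans_lt ?_
      have := hts x
      rw [dist_eq_norm] at this
      have hpos := norm_pos_iff.2 (hv' x).1
      nlinarith
    simp [h, (hv' x).2] at hlt
  have hnear (t : unitInterval) : ∀ᶠ s in nhds t, ∀ x, dist (P (t, x)) (P (s, x)) < 1 := by
    -- As `K` is compact, continuity of the curried map is uniform in `x`.
    let G : unitInterval → C(K, E →L[ℂ] E) :=
      (ContinuousMap.curry (⟨P, hP⟩ : C(unitInterval × K, E →L[ℂ] E)))
    have hG : Continuous G := map_continuous _
    filter_upwards [hG.continuousAt (Metric.ball_mem_nhds (G t) one_pos)] with s hs x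
    rw [dist_comm]
    exact (ContinuousMap.dist_apply_le_dist (f := G s) (g := G t) x).trans_lt hs
  have hclopen : IsClopen S := by
    refine ⟨⟨isOpen_iff_mem_nhds.2 fun t ht ↦ ?_⟩, isOpen_iff_mem_nhds.2 fun t ht ↦ ?_⟩
    · filter_upwards [hnear t] with s hs hsS
      exact ht (hstep s t (fun x ↦ by rw [dist_comm]; exact hs x) hsS)
    · filter_upwards [hnear t] with s hs
      exact hstep t s hs ht
  have h0 : (0 : unitInterval) ∈ S := by
    rw [hclopen.eq_univ ⟨1, h1⟩]
    exact Set.mem_univ _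
  exact h0

/-- The operator `(1 + x · σ) / 2` on spinors, with `σ` the Pauli matrices. -/
noncomputable def spinProjection (x : EuclideanSpace ℝ (Fin 3)) : ℂ × ℂ →L[ℂ] ℂ × ℂ :=
  (1 / 2 : ℂ) • (ContinuousLinearMap.id ℂ (ℂ × ℂ)
    + (x 0 : ℂ) • (ContinuousLinearMap.snd ℂ ℂ ℂ).prod (ContinuousLinearMap.fst ℂ ℂ ℂ)
    + (x 1 : ℂ) • (-Complex.I • ContinuousLinearMap.snd ℂ ℂ ℂ).prod
        (Complex.I • ContinuousLinearMap.fst ℂ ℂ ℂ)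
    + (x 2 : ℂ) • (ContinuousLinearMap.fst ℂ ℂ ℂ).prod (-ContinuousLinearMap.snd ℂ ℂ ℂ))

theorem spinProjection_apply (x : EuclideanSpace ℝ (Fin 3)) (v : ℂ × ℂ) :
    spinProjection x v =
      (((1 + x 2) * v.1 + (x 0 - Complex.I * x 1) * v.2) / 2,
        ((x 0 + Complex.I * x 1) * v.1 + (1 - x 2) * v.2) / 2) := by
  ext <;> simp [spinProjection] <;> ring

theorem continuous_spinProjection : Continuous spinProjection := by
  unfold spinProjection
  fun_prop

theorem sum_sq_coords_of_norm_eq_one {x : EuclideanSpace ℝ (Fin 3)} (hx : ‖x‖ = 1) :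
    x 0 ^ 2 + x 1 ^ 2 + x 2 ^ 2 = 1 := by
  have := EuclideanSpace.real_norm_sq_eq x
  rw [hx, Fin.sum_univ_three] at this
  linarith

/-- The Pauli relations give `(x · σ)² = |x|² = 1`. -/
theorem spinProjection_idem {x : EuclideanSpace ℝ (Fin 3)} (hx : ‖x‖ = 1) (v : ℂ × ℂ) :
    spinProjection x (spinProjection x v) = spinProjection x v := by
  have h : (x 0 : ℂ) ^ 2 + (x 1 : ℂ) ^ 2 + (x 2 : ℂ) ^ 2 = 1 := by
    simpa using congrArg Complex.ofReal (sum_sq_coords_of_norm_eq_one hx)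
  simp only [spinProjection_apply]
  ext
  · simp only
    linear_combination v.1 / 4 * h - v.1 / 4 * (x 1 : ℂ) ^ 2 * Complex.I_sq
  · simp only
    linear_combination v.2 / 4 * h - v.2 / 4 * (x 1 : ℂ) ^ 2 * Complex.I_sq

theorem exists_spinProjection_eq_self {x : EuclideanSpace ℝ (Fin 3)} (hx : ‖x‖ = 1) :
    ∃ v : ℂ × ℂ, v ≠ 0 ∧ spinProjection x v = v := by
  have h := sum_sq_coords_of_norm_eq_one hx
  by_cases h2 : 1 + x 2 = 0
  · have e2 : x 2 = -1 := by linarith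
    have e0 : x 0 = 0 := by nlinarith [sq_nonneg (x 0), sq_nonneg (x 1)]
    have e1 : x 1 = 0 := by nlinarith [sq_nonneg (x 0), sq_nonneg (x 1)]
    refine ⟨(0, 1), by simp, ?_⟩
    rw [spinProjection_apply]
    simp [e0, e1, e2]
  -- The first component is `(1 + x 2) / 2`, nonzero away from the south pole.
  · refine ⟨spinProjection x (1, 0), fun h0 ↦ h2 ?_, spinProjection_idem hx _⟩
    have := congrArg Prod.fst h0
    rw [spinProjection_apply] at this
    apply Complex.ofReal_injective
    simpa using this

/-- The inverse stereographic projection, up to the reflection given by the sign `ε`. -/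
noncomputable def stereoPoint (ε : ℝ) (z : ℂ) : EuclideanSpace ℝ (Fin 3) :=
  !₂[2 * z.re / (1 + ‖z‖ ^ 2), 2 * z.im / (1 + ‖z‖ ^ 2), ε * (1 - ‖z‖ ^ 2) / (1 + ‖z‖ ^ 2)]

theorem continuous_stereoPoint (ε : ℝ) : Continuous (stereoPoint ε) := by
  have (z : ℂ) : 1 + ‖z‖ ^ 2 ≠ 0 := by positivity
  refine (PiLp.continuous_toLp 2 _).comp (continuous_pi fun i ↦ ?_)
  fin_cases i <;> simp <;> fun_prop (disch := assumption)

theorem norm_stereoPoint {ε : ℝ} (hε : ε ^ 2 = 1) (z : ℂ) : ‖stereoPoint ε z‖ = 1 := by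
  have h0 : 1 + ‖z‖ ^ 2 ≠ 0 := by positivity
  have hz : ‖z‖ ^ 2 = z.re ^ 2 + z.im ^ 2 := by
    rw [← Complex.normSq_eq_norm_sq, Complex.normSq_apply]; ring
  rw [← sq_eq_sq₀ (norm_nonneg _) zero_le_one, EuclideanSpace.real_norm_sq_eq,
    Fin.sum_univ_three]
  simp only [stereoPoint, PiLp.toLp_apply, Matrix.cons_val_zero, Matrix.cons_val_one,
    Matrix.cons_val]
  field_simp
  linear_combination (1 - ‖z‖ ^ 2) ^ 2 * hε - 4 * hz

/-- The tautological line bundle of the sphere has no nowhere vanishing section. -/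
theorem not_exists_spin_section :
    ¬ ∃ v : Metric.sphere (0 : EuclideanSpace ℝ (Fin 3)) 1 → ℂ × ℂ,
      Continuous v ∧ ∀ x, v x ≠ 0 ∧ spinProjection x (v x) = v x := by
  rintro ⟨v, hv, hv'⟩
  let p (ε : ℝ) (hε : ε ^ 2 = 1) (z : ℂ) : Metric.sphere (0 : EuclideanSpace ℝ (Fin 3)) 1 :=
    ⟨stereoPoint ε z, by simpa using norm_stereoPoint hε z⟩
  have hp (ε : ℝ) (hε : ε ^ 2 = 1) : Continuous (p ε hε) :=
    (continuous_stereoPoint ε).subtype_mk _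
  -- The eigenvector equations in the chart. On the unit circle the third coordinate is 0, the
  -- charts agree, and the second equation reads `v.2 = z * v.1`.
  have hfix (ε : ℝ) (hε : ε ^ 2 = 1) (z : ℂ) :
      (1 - ε * (1 - (‖z‖ : ℂ) ^ 2) / (1 + (‖z‖ : ℂ) ^ 2)) * (v (p ε hε z)).1 =
        2 * (starRingEnd ℂ z) / (1 + (‖z‖ : ℂ) ^ 2) * (v (p ε hε z)).2 ∧
      (1 + ε * (1 - (‖z‖ : ℂ) ^ 2) / (1 + (‖z‖ : ℂ) ^ 2)) * (v (p ε hε z)).2 =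
        2 * z / (1 + (‖z‖ : ℂ) ^ 2) * (v (p ε hε z)).1 := by
    have h := (hv' (p ε hε z)).2
    have e0 : (p ε hε z).1 0 = 2 * z.re / (1 + ‖z‖ ^ 2) := rfl
    have e1 : (p ε hε z).1 1 = 2 * z.im / (1 + ‖z‖ ^ 2) := rfl
    have e2 : (p ε hε z).1 2 = ε * (1 - ‖z‖ ^ 2) / (1 + ‖z‖ ^ 2) := rfl
    rw [spinProjection_apply, e0, e1, e2] at h
    have h1 := congrArg Prod.fst h
    have h2 := congrArg Prod.snd h
    have hz : z = z.re + z.im * Complex.I := (Complex.re_add_im z).symm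
    have hzc : starRingEnd ℂ z = z.re - z.im * Complex.I := by
      apply Complex.ext <;> simp
    push_cast at h1 h2
    constructor
    · rw [hzc]
      linear_combination (-2) * h1
    · linear_combination (-2) * h2 - 2 / (1 + (‖z‖ : ℂ) ^ 2) * (v (p ε hε z)).1 * hz
  have hpos (z : ℂ) : 1 + (‖z‖ : ℂ) ^ 2 ≠ 0 := by
    have : 1 + ‖z‖ ^ 2 ≠ 0 := by positivity
    exact_mod_cast this
  have hone : (1 : ℝ) ^ 2 = 1 := one_pow 2
  have hneg : (-1 : ℝ) ^ 2 = 1 := by norm_num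
  refine not_mul_eq_on_circle (fun z ↦ (v (p 1 hone z)).1)
    (fun z ↦ (v (p (-1) hneg z)).2) (hv.comp (hp 1 hone)).fst
    (hv.comp (hp (-1) hneg)).snd
    (fun z h ↦ ?_) (fun z h ↦ ?_) fun z hz ↦ ?_
  -- The factor on the left of `hfix` is `2 / (1 + ‖z‖ ^ 2)`, so if one component vanishes, both do.
  · have := (hfix 1 hone z).2
    rw [h, mul_zero] at this
    refine (hv' (p 1 hone z)).1 (Prod.ext h ?_)
    refine (mul_eq_zero.1 this).resolve_left ?_
    have hz := hpos z
    field_simp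
    norm_num
  · have := (hfix (-1) hneg z).1
    rw [h, mul_zero] at this
    refine (hv' (p (-1) hneg z)).1 (Prod.ext ?_ h)
    refine (mul_eq_zero.1 this).resolve_left ?_
    have hz := hpos z
    field_simp
    push_cast
    ring_nf
    norm_num
  · have hpp : p (-1) hneg z = p 1 hone z := by
      simp [p, stereoPoint, hz]
    have := (hfix 1 hone z).2
    simp only [hpp]
    rw [hz] at this
    norm_num at this
    exact this.symm

/-- The two-dimensional sphere is not contractible. -/
theorem not_nullhomotopic_id_sphere :
    ¬ (ContinuousMap.id (Metric.sphere (0 : EuclideanSpace ℝ (Fin 3)) 1)).Nullhomotopic := by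
  rintro ⟨c, ⟨F⟩⟩
  refine not_exists_spin_section ?_
  have hc : ‖(c : EuclideanSpace ℝ (Fin 3))‖ = 1 := by simp
  obtain ⟨w, hw0, hw⟩ := exists_spinProjection_eq_self hc
  -- At time 1 the bundle is constant, with section `w`; at time 0 it is the spin bundle.
  have := exists_section_of_homotopy (fun q ↦ spinProjection (F q))
    (continuous_spinProjection.comp (continuous_subtype_val.comp F.continuous))
    (fun q v ↦ spinProjection_idem (by simp) v)
    ⟨fun _ ↦ w, continuous_const, fun x ↦ ⟨hw0, by simpa using hw⟩⟩
  simpa using this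

/-- The direction of the angular momentum of an orbit. -/
noncomputable def orbitDirection {b : ℝ} (hb : 0 ≤ b) :
    C(CurvilinearOrbits b, Metric.sphere (0 : EuclideanSpace ℝ (Fin 3)) 1) where
  toFun p := ⟨‖p.1.1‖⁻¹ • p.1.1, by
    have : 0 < ‖p.1.1‖ := hb.trans_lt p.2.2
    simp [norm_smul, this.ne']⟩
  continuous_toFun := by
    have (p : CurvilinearOrbits b) : ‖p.1.1‖ ≠ 0 := (hb.trans_lt p.2.2).ne'
    refine Continuous.subtype_mk ?_ _
    fun_prop (disch := assumption)

/-- The circular orbit with angular momentum `b + 1` in a given direction. -/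
noncomputable def circularOrbit {b : ℝ} (hb : 0 ≤ b) :
    C(Metric.sphere (0 : EuclideanSpace ℝ (Fin 3)) 1, CurvilinearOrbits b) where
  toFun x := ⟨((b + 1) • x.1, 0), by
    have hx : ‖x.1‖ = 1 := by simp
    simp [CurvilinearOrbits, norm_smul, hx, abs_of_nonneg (by linarith : 0 ≤ b + 1)]⟩
  continuous_toFun := by
    refine Continuous.subtype_mk ?_ _
    fun_prop

theorem orbitDirection_comp_circularOrbit {b : ℝ} (hb : 0 ≤ b) :
    (orbitDirection hb).comp (circularOrbit hb) = ContinuousMap.id _ := by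
  ext1 x
  have hx : ‖x.1‖ = 1 := by simp
  have hb1 : 0 < b + 1 := by linarith
  apply Subtype.ext
  simp [orbitDirection, circularOrbit, norm_smul, hx, abs_of_pos hb1, smul_smul, hb1.ne']

theorem theorem1 (b : ℝ) (hb : 0 ≤ b)
    (V : Type*) [AddCommGroup V] [Module ℝ V] [TopologicalSpace V]
    [IsTopologicalAddGroup V] [ContinuousSMul ℝ V] [FiniteDimensional ℝ V] :
    ¬ Nonempty (CurvilinearOrbits b ≃ₜ V) := by
  rintro ⟨e⟩
  have : ContractibleSpace V := inferInstance
  have : ContractibleSpace (CurvilinearOrbits b) := e.contractibleSpace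
  have h := ((id_nullhomotopic (CurvilinearOrbits b)).comp_left (circularOrbit hb)).comp_right
    (orbitDirection hb)
  refine not_nullhomotopic_id_sphere ?_
  rw [← orbitDirection_comp_circularOrbit hb]
  exact h
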